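/- Let $n\ge 1$ and consider operators on an $n$-dimensional Hilbert space. An ensemble is a (discrete or continuous) family $\{\rho_x\}$ of positive semidefinite operators with $\operatorname{Tr}\sum_x\rho_x=1$ (it averages to the state $\sum_x\rho_x$), a POVM is a (discrete or continuous) family $\{\pi_y\}$ of positive semidefinite operators with $\sum_y\pi_y=\mathbb 1$; in the continuous case sums are replaced by integrals. Let $I(\{p_{x,y}\})=\sum_{x,y}p_{x,y}\ln\frac{p_{x,y}}{p_xp_y}$ be the mutual information, with $p_x,p_y$ the marginals. The accessible information is $A(\{\rho_x\})=\max_{\{\pi_y\}} I(\{\operatorname{Tr}[\rho_x\pi_y]\})$, the informational power is $W(\{\pi_y\})=\max_{\{\rho_x\}} I(\{\operatorname{Tr}[\rho_x\pi_y]\})$, and the purity is $P(X)=\operatorname{Tr}[X^2]/(\operatorname{Tr}X)^2$. For $P\in[1/n,1]$ let $S_A(\rho,P)$ be the maximum of $A(\{\rho_x\})$ over the ensembles averaging to $\rho$ with $P(\rho_x)\le P$ for all $x$, and $S_W(P)$ the maximum of $W(\{\pi_y\})$ over the POVMs with $P(\pi_y)\le P$ for all $y$ (all these maxima are read as suprema).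 Put $m=\lfloor 1/P\rfloor$, $\alpha=m+1$, $$a=\frac{1+\sqrt{(P\alpha-1)/m}}{\alpha},\qquad b=\frac{1-\sqrt{m(P\alpha-1)}}{\alpha}.$$ Then, with $0\ln 0=0$, $$S_W(P)\ \ge\ \max_\rho S_A(\rho,P)\ =\ \ln n+m\,a\ln a+b\ln b ,$$ where the maximum over all states $\rho$ is attained. Moreover, let $\{|k\rangle\}_{k=0}^{n-1}$ be any orthonormal basis and $\lambda=(a,\dots,a,b,0,\dots,0)\in\mathbb R^n$, with $m$ entries $a$ followed by one entry $b$ (if $m=n$ then $b=0$ and $\lambda=(a,\dots,a)$). Then $\max_\rho S_A(\rho,P)$ is attained by any ensemble of $n$ commuting states $\rho_x=\sum_k\lambda_k|\sigma_x(k)\rangle\langle\sigma_x(k)|$, each taken with probability $1/n$, where $\sigma_0,\dots,\sigma_{n-1}$ are permutations of $\{0,\dots,n-1\}$ such that $\frac1n\sum_x\rho_x=\mathbb 1/n$: its states have purity at most $P$, and its accessible information equals this value and is attained by some POVM. The cyclic shifts $\sigma_x(k)=x+k \bmod n$ are such permutations. -/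

import Mathlib

open MeasureTheory
open scoped ComplexOrder

namespace QInfo

/-- A (discrete or continuous) family of positive semidefinite operators on an `n`-dimensional
Hilbert space: an index space `X` with a reference measure `μ` and an integrable density
`x ↦ op x ≥ 0`. A discrete family is the case of the counting measure. -/
structure OpFamily (n : ℕ) where
  X : Type
  [measurableSpace : MeasurableSpace X]
  μ : Measure X
  [sigmaFinite : SigmaFinite μ]
  op : X → Matrix (Fin n) (Fin n) ℂ
  posSemidef : ∀ x, (op x).PosSemidef
  integrable : ∀ i j, Integrable (fun x => op x i j) μ

attribute [instance] OpFamily.measurableSpace OpFamily.sigmaFinite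

variable {n : ℕ}

/-- The sum (integral) of all the operators of the family, computed entrywise. -/
noncomputable def OpFamily.total (F : OpFamily n) : Matrix (Fin n) (Fin n) ℂ :=
  Matrix.of fun i j => ∫ x, F.op x i j ∂F.μ

/-- A quantum ensemble: sub-normalized states `ρ_x ≥ 0` with `Tr ∑ ρ_x = 1`. -/
structure Ensemble (n : ℕ) extends OpFamily n where
  trace_total : toOpFamily.total.trace = 1

/-- A POVM: operators `π_y ≥ 0` with `∑ π_y = 1`. -/
structure POVM (n : ℕ) extends OpFamily n where
  total_eq_one : toOpFamily.total = 1

/-- Density matrices. -/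
def IsState (ρ : Matrix (Fin n) (Fin n) ℂ) : Prop := ρ.PosSemidef ∧ ρ.trace = 1

/-- The purity `Tr[A²] / (Tr A)²` (with value `0` at `A = 0`, so that null elements of an ensemble
or a POVM are never excluded by an upper bound on the purity). -/
noncomputable def purity (A : Matrix (Fin n) (Fin n) ℂ) : ℝ :=
  (A * A).trace.re / A.trace.re ^ 2

/-- (Almost) all operators of the family have purity at most `P`. -/
def OpFamily.PurityLE (F : OpFamily n) (P : ℝ) : Prop :=
  ∀ᵐ x ∂F.μ, purity (F.op x) ≤ P

/-- The Born rule `p_{x,y} = Tr[ρ_x π_y]`. -/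
noncomputable def born (E : Ensemble n) (M : POVM n) (x : E.X) (y : M.X) : ℝ :=
  (E.op x * M.op y).trace.re

/-- The mutual information `∑_{x,y} p_{x,y} ln (p_{x,y} / (p_x p_y))`, where `p_x` and `p_y` are
the marginals of `p_{x,y}`. -/
noncomputable def mutualInfo (E : Ensemble n) (M : POVM n) : ℝ :=
  ∫ z : E.X × M.X, born E M z.1 z.2 *
    Real.log (born E M z.1 z.2 / ((∫ y, born E M z.1 y ∂M.μ) * (∫ x, born E M x z.2 ∂E.μ)))
    ∂(E.μ.prod M.μ)

/-- The accessible information `A` of an ensemble. -/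
noncomputable def accessibleInfo (E : Ensemble n) : EReal :=
  ⨆ M : POVM n, (mutualInfo E M : EReal)

/-- The informational power `W` of a POVM. -/
noncomputable def infoPower (M : POVM n) : EReal :=
  ⨆ E : Ensemble n, (mutualInfo E M : EReal)

/-- `S_A(ρ, P)`: the largest accessible information of an ensemble averaging to `ρ` whose states
have purity at most `P` (it is `⊥` if there is no such ensemble). -/
noncomputable def SA (ρ : Matrix (Fin n) (Fin n) ℂ) (P : ℝ) : EReal :=
  ⨆ (E : Ensemble n) (_ : E.total = ρ ∧ E.PurityLE P), accessibleInfo E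

/-- `S_W(P)`: the largest informational power of a POVM whose elements have purity at most `P`. -/
noncomputable def SW (n : ℕ) (P : ℝ) : EReal :=
  ⨆ (M : POVM n) (_ : M.PurityLE P), infoPower M

/-- A finite ensemble, given by a list of sub-normalized states. -/
noncomputable def Ensemble.ofFin {N : ℕ} (ρ : Fin N → Matrix (Fin n) (Fin n) ℂ)
    (hpos : ∀ x, (ρ x).PosSemidef) (htr : (∑ x, ρ x).trace = 1) : Ensemble n where
  X := Fin N
  μ := Measure.count
  op := ρ
  posSemidef := hpos
  integrable := fun _ _ => Integrable.of_finite
  trace_total := by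
    rw [← htr]
    congr 1
    ext i j
    simp [OpFamily.total, Matrix.sum_apply, integral_fintype Integrable.of_finite]

/-- The rank-one projection `|v⟩⟨v|` for a unit vector `v`. -/
noncomputable def ketBra (v : EuclideanSpace ℂ (Fin n)) : Matrix (Fin n) (Fin n) ℂ :=
  Matrix.vecMulVec (fun i => v i) (fun i => star (v i))

/-- The spectrum `(a, …, a, b, 0, …, 0)` with `m` entries `a` and (if `m < n`) one entry `b`. -/
def twoLevel (m : ℕ) (a b : ℝ) (k : Fin n) : ℝ :=
  if (k : ℕ) < m then a else if (k : ℕ) = m then b else 0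

/-- The state `∑_k λ_k |s(k)⟩⟨s(k)|`, where `λ = (a, …, a, b, 0, …, 0)`, the vectors `|k⟩` are the
given orthonormal basis and `s` is a permutation of the labels. -/
noncomputable def twoLevelState (e : OrthonormalBasis (Fin n) ℂ (EuclideanSpace ℂ (Fin n)))
    (m : ℕ) (a b : ℝ) (s : Equiv.Perm (Fin n)) : Matrix (Fin n) (Fin n) ℂ :=
  ∑ k : Fin n, (twoLevel m a b k : ℂ) • ketBra (e (s k))

end QInfo

namespace QInfo

/-! Upper bound. Write `ρ_x` with eigenvalues `μ_k` and eigenvectors `e_k`, and set `s = Tr ρ_x`, `q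
= Tr π_y`, `d_k = ⟨e_k|π_y|e_k⟩`, `p = Tr[ρ_x π_y]`, `r = Tr[ρ π_y]`. Then `p / (s q)` is the mean
of the `μ_k / s` with weights `d_k / q`. Jensen's inequality for `t ln t`, integrated over `y` (each
`d_k` integrates to 1), bounds the part `∑ p ln (p / (s q))` by the mean of minus the entropies of
the spectra. The rest is `∑ p ln (q / r)`, which is at most `ln n` by Gibbs' inequality for the
outcome distribution `r` against `q / n`. This is `mutualInfo_le`.

A spectrum of purity at most `P` is a probability vector with `∑ l_i² ≤ P`, so it remains to find
the least entropy of such vectors (`sum_mul_log_le`). Two perturbations determine the minimizer: a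
pair move forces `∑ l_i² = P`, and a triple move allows at most one positive entry below the largest
value. Sum and sum of squares then fix `m`, `a`, `b`.

Equality. For permuted copies of this spectrum averaging to `1 / n`, measured in the common
eigenbasis, the joint distribution is a doubly stochastic matrix over `n`, whose mutual information
is exactly the bound. Exchanging the roles of states and effects gives the same value for `S_W`. -/

/-! ### Probability vectors of least entropy under a bound on the sum of squares. -/

lemma log_chord_lt {x y z : ℝ} (hz : 0 < z) (hzy : z < y) (hyx : y < x) :
    (y - z) * Real.log x + (x - y) * Real.log z < (x - z) * Real.log y := by
  have hxz : 0 < x - z := by linarith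
  have h := strictConcaveOn_log_Ioi.2 (Set.mem_Ioi.2 (by linarith : (0 : ℝ) < x))
    (Set.mem_Ioi.2 hz) (by linarith : z < x).ne'
    (div_pos (sub_pos.2 hzy) hxz) (div_pos (sub_pos.2 hyx) hxz) (by field_simp; ring)
  simp only [smul_eq_mul] at h
  have e : (y - z) / (x - z) * x + (x - y) / (x - z) * z = y := by field_simp; ring
  rw [e] at h
  have h2 := mul_lt_mul_of_pos_left h hxz
  calc _ = (x - z) * ((y - z) / (x - z) * Real.log x + (x - y) / (x - z) * Real.log z) := by
        field_simp
    _ < _ := h2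

/-- Three positive reals whose two largest are different can be moved, with constant sum and
constant sum of squares, so that their entropy decreases. -/
lemma exists_triple_mul_log_lt {x y z : ℝ} (hz : 0 < z) (hzy : z ≤ y) (hyx : y < x) :
    ∃ x' y' z' : ℝ, 0 ≤ x' ∧ 0 ≤ y' ∧ 0 ≤ z' ∧ x' + y' + z' = x + y + z ∧
      x' ^ 2 + y' ^ 2 + z' ^ 2 = x ^ 2 + y ^ 2 + z ^ 2 ∧
      x * Real.log x + y * Real.log y + z * Real.log z <
        x' * Real.log x' + y' * Real.log y' + z' * Real.log z' := by
  -- When `z` becomes `z - t`, the two constraints force the other two entries to have sum `x + y +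
  -- t` and squared difference `h t`; `h 0 > 0` because `y < x`.
  set h : ℝ → ℝ := fun t => (x - y) ^ 2 - (2 * (x + y) - 4 * z) * t - 3 * t ^ 2 with hh
  obtain ⟨ε, hε, hεz, hεh⟩ : ∃ ε : ℝ, 0 < ε ∧ ε < z ∧ 0 < h ε := by
    have hc : Continuous h := by fun_prop
    have h0 : 0 < h 0 := by
      have : 0 < x - y := by linarith
      simpa [hh] using pow_pos this 2
    have e1 := (hc.tendsto 0).eventually (lt_mem_nhds h0)
    have e2 : ∀ᶠ t : ℝ in nhds 0, t < z := gt_mem_nhds hz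
    have e3 := (e1.and e2).filter_mono (nhdsWithin_le_nhds (s := Set.Ioi 0))
    obtain ⟨t, ⟨ht1, ht2⟩, ht3⟩ := (e3.and self_mem_nhdsWithin).exists
    exact ⟨t, ht3, ht2, ht1⟩
  have hpos : ∀ t, 0 ≤ t → t ≤ ε → 0 < h t := by
    intro t ht0 ht
    refine lt_of_lt_of_le hεh ?_
    simp only [hh]
    have : 0 ≤ 2 * (x + y) - 4 * z := by linarith
    nlinarith [mul_le_mul_of_nonneg_left ht this]
  set D : ℝ → ℝ := fun t => Real.sqrt (h t) with hD
  set X : ℝ → ℝ := fun t => (x + y + t + D t) / 2 with hX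
  set Y : ℝ → ℝ := fun t => (x + y + t - D t) / 2 with hY
  have hDpos : ∀ t, 0 ≤ t → t ≤ ε → 0 < D t := fun t h0 h1 => Real.sqrt_pos.2 (hpos t h0 h1)
  have hDsq : ∀ t, 0 ≤ t → t ≤ ε → D t ^ 2 = h t := fun t h0 h1 => Real.sq_sqrt (hpos t h0 h1).le
  have hDle : ∀ t, 0 ≤ t → D t ≤ x - y := by
    intro t h0
    apply Real.sqrt_le_iff.2 ⟨by linarith, ?_⟩
    simp only [hh]
    have : 0 ≤ 2 * (x + y) - 4 * z := by linarith
    nlinarith [mul_nonneg this h0, sq_nonneg t]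
  have hD0 : D 0 = x - y := by
    simpa [hD, hh] using Real.sqrt_sq (by linarith : 0 ≤ x - y)
  have hDc : Continuous D := by simp only [hD, hh]; fun_prop
  have hXc : Continuous X := by simp only [hX]; fun_prop
  have hYc : Continuous Y := by simp only [hY]; fun_prop
  set Φ : ℝ → ℝ := fun t => X t * Real.log (X t) + Y t * Real.log (Y t) +
    (z - t) * Real.log (z - t) with hΦ
  have hΦc : Continuous Φ := by
    have h3 : Continuous fun t : ℝ => z - t := by fun_prop
    exact ((Real.continuous_mul_log.comp hXc).add (Real.continuous_mul_log.comp hYc)).add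
      (Real.continuous_mul_log.comp h3)
  have hmono : StrictMonoOn Φ (Set.Icc 0 ε) := by
    refine strictMonoOn_of_deriv_pos (convex_Icc 0 ε) hΦc.continuousOn fun t ht => ?_
    rw [interior_Icc] at ht
    obtain ⟨ht0, ht1⟩ := ht
    have hd := hDpos t ht0.le ht1.le
    have hZ : 0 < z - t := by linarith
    have hYZ : z - t < Y t := by
      have := hDle t ht0.le
      simp only [hY]; linarith
    have hXY : Y t < X t := by simp only [hX, hY]; linarith
    have d1 : HasDerivAt h (-(2 * (x + y) - 4 * z) - 6 * t) t := by
      have := (((hasDerivAt_id t).const_mul (2 * (x + y) - 4 * z)).const_sub ((x - y) ^ 2)).sub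
        (((hasDerivAt_id t).pow 2).const_mul 3)
      refine HasDerivAt.congr_deriv (f := h) this ?_
      norm_num
      ring
    have d2 : HasDerivAt D ((-(2 * (x + y) - 4 * z) - 6 * t) / (2 * D t)) t :=
      d1.sqrt (hpos t ht0.le ht1.le).ne'
    have d3 : HasDerivAt X ((1 + (-(2 * (x + y) - 4 * z) - 6 * t) / (2 * D t)) / 2) t := by
      simpa using (((hasDerivAt_id t).const_add (x + y)).add d2).div_const 2
    have d4 : HasDerivAt Y ((1 - (-(2 * (x + y) - 4 * z) - 6 * t) / (2 * D t)) / 2) t := by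
      simpa using (((hasDerivAt_id t).const_add (x + y)).sub d2).div_const 2
    have d5 : HasDerivAt (fun t => z - t) (-1) t := by
      simpa using (hasDerivAt_id t).const_sub z
    have d6 := (((Real.hasDerivAt_mul_log (by linarith : (0:ℝ) < X t).ne').comp t d3).add
      ((Real.hasDerivAt_mul_log (by linarith : (0:ℝ) < Y t).ne').comp t d4)).add
      ((Real.hasDerivAt_mul_log hZ.ne').comp t d5)
    have d7 : HasDerivAt Φ _ t := d6
    rw [d7.deriv]
    -- The derivatives of the three entries are `-(Y - Z) / D`, `(X - Z) / D` and `-1`, where `Z = z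
    -- - t`; strict concavity of `ln` at `Z < Y < X` makes the derivative of `Φ` positive.
    have key := log_chord_lt hZ hYZ hXY
    have eD : X t - Y t = D t := by simp only [hX, hY]; ring
    have e1 : (1 + (-(2 * (x + y) - 4 * z) - 6 * t) / (2 * D t)) / 2 =
        - (Y t - (z - t)) / D t := by
      simp only [hY]; field_simp; ring
    have e2 : (1 - (-(2 * (x + y) - 4 * z) - 6 * t) / (2 * D t)) / 2 =
        (X t - (z - t)) / D t := by
      simp only [hX]; field_simp; ring
    rw [e1, e2]
    have : (Real.log (X t) + 1) * (-(Y t - (z - t)) / D t) +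
        (Real.log (Y t) + 1) * ((X t - (z - t)) / D t) + (Real.log (z - t) + 1) * -1 =
        ((X t - (z - t)) * Real.log (Y t) - ((Y t - (z - t)) * Real.log (X t) +
          (X t - Y t) * Real.log (z - t))) / D t := by
      rw [← eD] at hd ⊢
      field_simp
      ring
    rw [this]
    exact div_pos (by linarith) hd
  have hX0 : X 0 = x := by simp only [hX, hD0]; ring
  have hY0 : Y 0 = y := by simp only [hY, hD0]; ring
  have hlt := hmono (Set.left_mem_Icc.2 hε.le) (Set.right_mem_Icc.2 hε.le) hε
  simp only [hΦ, hX0, hY0, sub_zero] at hlt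
  have hdε := hDpos ε hε.le le_rfl
  have hle := hDle ε hε.le
  refine ⟨X ε, Y ε, z - ε, ?_, ?_, by linarith, ?_, ?_, hlt⟩
  · simp only [hX]; linarith
  · simp only [hY]; linarith
  · simp only [hX, hY]; ring
  · have := hDsq ε hε.le le_rfl
    simp only [hh] at this
    simp only [hX, hY]
    linear_combination this / 2

/-- Moving weight from the smaller to the larger of two positive reals decreases their entropy. -/
lemma pair_mul_log_lt {x y t : ℝ} (hy : 0 ≤ y - t) (hyx : y ≤ x) (ht : 0 < t) :
    x * Real.log x + y * Real.log y <
      (x + t) * Real.log (x + t) + (y - t) * Real.log (y - t) := by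
  -- `d` is the gap between the new values `x + t` and `y - t`; the old values are their convex
  -- combinations with weights `(d - t) / d` and `t / d`, in the two orders.
  obtain ⟨d, rfl⟩ : ∃ d, x = d + y - 2 * t := ⟨x - y + 2 * t, by ring⟩
  have hd : 0 < d := by linarith
  have m1 : d + y - 2 * t + t ∈ Set.Ici (0 : ℝ) := Set.mem_Ici.2 (by linarith)
  have m2 : y - t ∈ Set.Ici (0 : ℝ) := Set.mem_Ici.2 hy
  have hne : d + y - 2 * t + t ≠ y - t := by intro h; linarith
  have p1 : 0 < (d - t) / d := div_pos (by linarith) hd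
  have p2 : 0 < t / d := div_pos ht hd
  have e3 : (d - t) / d + t / d = 1 := by field_simp; ring
  have h1 := Real.strictConvexOn_mul_log.2 m1 m2 hne p1 p2 e3
  have h2 := Real.strictConvexOn_mul_log.2 m1 m2 hne p2 p1 ((add_comm _ _).trans e3)
  simp only [smul_eq_mul] at h1 h2
  have e1 : (d - t) / d * (d + y - 2 * t + t) + t / d * (y - t) = d + y - 2 * t := by
    field_simp; ring
  have e2 : t / d * (d + y - 2 * t + t) + (d - t) / d * (y - t) = y := by
    field_simp; ring
  rw [e1] at h1
  rw [e2] at h2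
  refine (add_lt_add h1 h2).trans_eq ?_
  linear_combination ((d + y - 2 * t + t) * Real.log (d + y - 2 * t + t) +
    (y - t) * Real.log (y - t)) * e3

lemma sum_comp_update {ι : Type*} [Fintype ι] [DecidableEq ι] (f : ℝ → ℝ) (l : ι → ℝ) (i : ι)
    (x : ℝ) : ∑ k, f (Function.update l i x k) = ∑ k, f (l k) + (f x - f (l i)) := by
  rw [← Finset.add_sum_erase _ _ (Finset.mem_univ i),
    ← Finset.add_sum_erase (a := i) _ (fun k => f (l k)) (Finset.mem_univ i)]
  rw [Finset.sum_congr rfl (g := fun k => f (l k)) fun k hk => by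
    rw [Function.update_of_ne (Finset.ne_of_mem_erase hk)]]
  simp only [Function.update_self]
  ring

/-- The probability vectors with `∑ l_i² ≤ P`. -/
def simplexBall (ι : Type*) [Fintype ι] (P : ℝ) : Set (ι → ℝ) :=
  {l | (∀ i, 0 ≤ l i) ∧ ∑ i, l i = 1 ∧ ∑ i, l i ^ 2 ≤ P}

lemma isCompact_simplexBall (ι : Type*) [Fintype ι] (P : ℝ) : IsCompact (simplexBall ι P) := by
  refine (isCompact_Icc (a := (0 : ι → ℝ)) (b := 1)).of_isClosed_subset ?_ ?_
  · refine IsClosed.inter (isClosed_le (f := fun _ => (0 : ι → ℝ)) continuous_const continuous_id)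
      (IsClosed.inter ?_ ?_)
    · exact isClosed_eq (f := fun l : ι → ℝ => ∑ i, l i) (by fun_prop) continuous_const
    · exact isClosed_le (f := fun l : ι → ℝ => ∑ i, l i ^ 2) (by fun_prop) continuous_const
  · rintro l ⟨h0, h1, -⟩
    exact ⟨h0, fun i => (Finset.single_le_sum (fun j _ => h0 j) (Finset.mem_univ i)).trans h1.le⟩

/-- The shape of the probability vectors of minimal entropy among those with `∑ l_i² ≤ P`. -/
lemma exists_two_level_of_isMaxOn {ι : Type*} [Fintype ι] {P : ℝ} (hP1 : P ≤ 1) {l : ι → ℝ}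
    (hl : l ∈ simplexBall ι P)
    (hmax : IsMaxOn (fun l : ι → ℝ => ∑ i, l i * Real.log (l i)) (simplexBall ι P) l) :
    ∃ (p : ℕ) (u w : ℝ), 1 ≤ p ∧ 0 ≤ w ∧ w < u ∧ p * u + w = 1 ∧ p * u ^ 2 + w ^ 2 = P ∧
      ∑ i, l i * Real.log (l i) = p * (u * Real.log u) + w * Real.log w := by
  classical
  obtain ⟨h0, h1, hP⟩ := hl
  have hne : Nonempty ι := by
    by_contra h
    rw [not_nonempty_iff] at h
    simp at h1
  obtain ⟨i, hi⟩ := Finite.exists_max l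
  have hipos : 0 < l i := by
    by_contra h
    have : ∑ j, l j ≤ 0 := Finset.sum_nonpos fun j _ => (hi j).trans (not_lt.1 h)
    linarith
  -- If the bound were slack, a little weight could be moved from another positive entry to the
  -- largest one; with no such entry, `l` is a point mass and `∑ l_j² = 1 ≥ P`.
  have hsq : ∑ j, l j ^ 2 = P := by
    refine le_antisymm hP (not_lt.1 fun hlt => ?_)
    by_cases hex : ∃ j, j ≠ i ∧ 0 < l j
    · obtain ⟨j, hji, hj⟩ := hex
      have hc : Continuous fun t : ℝ =>
          ∑ k, l k ^ 2 + ((l i + t) ^ 2 - l i ^ 2) + ((l j - t) ^ 2 - l j ^ 2) := by fun_prop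
      have e1 := (hc.tendsto 0).eventually (gt_mem_nhds (by simpa using hlt) : ∀ᶠ s in nhds _, s < P)
      have e2 : ∀ᶠ t : ℝ in nhds 0, t < l j := gt_mem_nhds hj
      have e3 := (e1.and e2).filter_mono (nhdsWithin_le_nhds (s := Set.Ioi 0))
      obtain ⟨t, ⟨ht1, ht2⟩, ht3⟩ := (e3.and self_mem_nhdsWithin).exists
      have ht0 : 0 < t := ht3
      have key : ∀ f : ℝ → ℝ,
          ∑ k, f (Function.update (Function.update l i (l i + t)) j (l j - t) k) =
          ∑ k, f (l k) + (f (l i + t) - f (l i)) + (f (l j - t) - f (l j)) := by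
        intro f
        rw [sum_comp_update, sum_comp_update, Function.update_of_ne hji]
      have hmem : Function.update (Function.update l i (l i + t)) j (l j - t) ∈
          simplexBall ι P := by
        refine ⟨fun k => ?_, ?_, ?_⟩
        · rw [Function.update_apply, Function.update_apply]
          split_ifs
          · linarith
          · linarith
          · exact h0 k
        · rw [key fun x => x, h1]; ring
        · rw [key fun x => x ^ 2]; exact ht1.le
      have h2 := hmax hmem
      simp only [Set.mem_ofPred_eq] at h2
      rw [key fun x => x * Real.log x] at h2
      have := pair_mul_log_lt (sub_nonneg.2 ht2.le) (hi j) ht0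
      linarith
    · push Not at hex
      have hz : ∀ j, j ≠ i → l j = 0 := fun j hj => le_antisymm (hex j hj) (h0 j)
      rw [Finset.sum_eq_single i (fun j _ hj => hz j hj) (by simp)] at h1
      rw [Finset.sum_eq_single i (fun j _ hj => by simp [hz j hj]) (by simp), h1] at hlt
      linarith
  -- Two positive entries below the maximum, together with a maximal one, would allow the
  -- entropy-decreasing triple move.
  have htriple : ∀ j k, j ≠ k → l j ≠ l i → l k ≠ l i → 0 < l j → 0 < l k → False := by
    intro j k hjk hj hk hj0 hk0
    wlog hkj : l k ≤ l j generalizing j k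
    · exact this k j hjk.symm hk hj hk0 hj0 (not_le.1 hkj).le
    obtain ⟨x', y', z', hx', hy', hz', hs, hq, hlt⟩ :=
      exists_triple_mul_log_lt hk0 hkj (lt_of_le_of_ne (hi j) hj)
    have hji : j ≠ i := fun h => hj (by rw [h])
    have hki : k ≠ i := fun h => hk (by rw [h])
    have key : ∀ f : ℝ → ℝ, ∑ r, f (Function.update (Function.update (Function.update l i x')
          j y') k z' r) =
        ∑ r, f (l r) + (f x' - f (l i)) + (f y' - f (l j)) + (f z' - f (l k)) := by
      intro f
      rw [sum_comp_update, sum_comp_update, sum_comp_update, Function.update_of_ne hji,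
        Function.update_of_ne hjk.symm, Function.update_of_ne hki]
    have hmem : Function.update (Function.update (Function.update l i x') j y') k z' ∈
        simplexBall ι P := by
      refine ⟨fun r => ?_, ?_, ?_⟩
      · rw [Function.update_apply, Function.update_apply, Function.update_apply]
        split_ifs
        exacts [hz', hy', hx', h0 r]
      · rw [key fun x => x]; linarith
      · rw [key fun x => x ^ 2]; linarith
    have h2 := hmax hmem
    simp only [Set.mem_ofPred_eq] at h2
    rw [key fun x => x * Real.log x] at h2
    linarith
  -- `w` is the only positive entry below the maximum, or 0 if there is none; `f 0 = 0` removes all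
  -- the others.
  obtain ⟨w, hw0, hwu, hw⟩ : ∃ w, 0 ≤ w ∧ w < l i ∧ ∀ f : ℝ → ℝ, f 0 = 0 →
      ∑ j with l j ≠ l i, f (l j) = f w := by
    by_cases hex : ∃ j, l j ≠ l i ∧ 0 < l j
    · obtain ⟨j, hj, hj0⟩ := hex
      refine ⟨l j, hj0.le, lt_of_le_of_ne (hi j) hj, fun f hf => ?_⟩
      refine Finset.sum_eq_single_of_mem j (by simpa using hj) fun k hk hkj => ?_
      have hk' : l k ≠ l i := by simpa using hk
      rw [le_antisymm (not_lt.1 fun h => htriple j k hkj.symm hj hk' hj0 h) (h0 k), hf]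
    · push Not at hex
      refine ⟨0, le_rfl, hipos, fun f hf => ?_⟩
      rw [hf]
      refine Finset.sum_eq_zero fun k hk => ?_
      rw [le_antisymm (hex k (by simpa using hk)) (h0 k), hf]
  have key : ∀ f : ℝ → ℝ, f 0 = 0 →
      ∑ j, f (l j) = (Finset.univ.filter fun j => l j = l i).card * f (l i) + f w := by
    intro f hf
    rw [← Finset.sum_filter_add_sum_filter_not _ (fun j => l j = l i), hw f hf]
    congr 1
    rw [Finset.sum_congr rfl (g := fun _ => f (l i)) fun j hj => by
      rw [(Finset.mem_filter.1 hj).2]]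
    simp
  refine ⟨(Finset.univ.filter fun j => l j = l i).card, l i, w, ?_, hw0, hwu, ?_, ?_, ?_⟩
  · exact Finset.card_pos.2 ⟨i, by simp⟩
  · rw [← h1, key (fun x => x) rfl]
  · rw [← hsq, key (fun x => x ^ 2) (by simp)]
  · exact key (fun x => x * Real.log x) (by simp)

/-- With `p u + w = 1` and `p u² + w² = P`, one has `1 - p P = 2 p u w - (p - 1) w² ≥ 0` and `(p +
1) P - 1 = p (u - w)² > 0`, which identifies `p` as `⌊1/P⌋`. -/
lemma two_level_eq {P : ℝ} {m p : ℕ} {a b u w : ℝ} (hm : m = ⌊P⁻¹⌋₊) (hp : 1 ≤ p)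
    (ha : a = (1 + Real.sqrt ((P * (m + 1) - 1) / m)) / (m + 1)) (hb : b = 1 - m * a)
    (hw : 0 ≤ w) (hwu : w < u) (h1 : p * u + w = 1) (h2 : p * u ^ 2 + w ^ 2 = P) :
    p = m ∧ u = a ∧ w = b := by
  have hp1 : (1 : ℝ) ≤ p := by exact_mod_cast hp
  have hu : 0 < u := by linarith
  have hP : 0 < P := by rw [← h2]; positivity
  have l1 : p * P ≤ 1 := by
    have e : (1 : ℝ) - p * P = 2 * p * u * w - (p - 1) * w ^ 2 := by
      rw [← h2]; linear_combination -(p * u + w + 1) * h1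
    have e2 : (p - 1) * w ^ 2 ≤ 2 * p * u * w := by
      have := mul_le_mul_of_nonneg_left hwu.le hw
      nlinarith [mul_nonneg hw hu.le, mul_nonneg (mul_nonneg (by linarith : (0:ℝ) ≤ p) hw) hu.le,
        mul_le_mul_of_nonneg_left this (by linarith : (0:ℝ) ≤ p - 1)]
    linarith
  have l2 : 1 < (p + 1) * P := by
    have e : (p + 1) * P - 1 = p * (u - w) ^ 2 := by
      rw [← h2]; linear_combination (p * u + w + 1) * h1
    have : 0 < p * (u - w) ^ 2 := mul_pos (by linarith) (pow_pos (by linarith) 2)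
    linarith
  have hpm : p = m := by
    rw [hm, eq_comm, Nat.floor_eq_iff (by positivity)]
    constructor
    · rw [le_inv_comm₀ (by linarith) hP, ← one_div, le_div_iff₀ (by linarith)]; linarith
    · rw [inv_lt_iff_one_lt_mul₀ hP]; linarith
  have hua : u = a := by
    rw [ha, ← hpm, eq_div_iff (by positivity)]
    -- Here `(p + 1) u - 1 = u - w` is positive, which selects the positive square root.
    have : (P * (p + 1) - 1) / p = ((p + 1) * u - 1) ^ 2 := by
      rw [div_eq_iff (by linarith), ← h2]
      linear_combination (1 - p * u + w) * (p + 1) * h1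
    rw [this, Real.sqrt_sq (by linarith)]
    ring
  refine ⟨hpm, hua, ?_⟩
  rw [hb, ← hpm, ← hua]
  linarith

/-- The least entropy of a probability vector with `∑ l_i² ≤ P`. -/
lemma sum_mul_log_le {ι : Type*} [Fintype ι] {P : ℝ} (hP1 : P ≤ 1) {m : ℕ} {a b : ℝ}
    (hm : m = ⌊P⁻¹⌋₊) (ha : a = (1 + Real.sqrt ((P * (m + 1) - 1) / m)) / (m + 1))
    (hb : b = 1 - m * a) {l : ι → ℝ} (hl : l ∈ simplexBall ι P) :
    ∑ i, l i * Real.log (l i) ≤ m * (a * Real.log a) + b * Real.log b := by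
  have hc : Continuous fun l : ι → ℝ => ∑ i, l i * Real.log (l i) :=
    continuous_finsetSum _ fun i _ => Real.continuous_mul_log.comp (continuous_apply i)
  obtain ⟨l', hl', hmax⟩ :=
    (isCompact_simplexBall ι P).exists_isMaxOn ⟨l, hl⟩ hc.continuousOn
  obtain ⟨p, u, w, hp, hw, hwu, h1, h2, h3⟩ := exists_two_level_of_isMaxOn hP1 hl' hmax
  obtain ⟨rfl, rfl, rfl⟩ := two_level_eq hm hp ha hb hw hwu h1 h2
  rw [← h3]
  exact hmax hl

/-- Both radicals come from the single number `r`, with `a = (1 + r / m) / (m + 1)` and `b = (1 - r)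
/ (m + 1)`. The last clause is needed when `m = n`, where the spectrum has no place for `b`. -/
lemma two_level_facts {P : ℝ} (hP0 : 0 < P) (hP1 : P ≤ 1) {m : ℕ} {a b : ℝ}
    (hm : m = ⌊P⁻¹⌋₊) (ha : a = (1 + Real.sqrt ((P * (m + 1) - 1) / m)) / (m + 1))
    (hb : b = (1 - Real.sqrt (m * (P * (m + 1) - 1))) / (m + 1)) :
    0 ≤ a ∧ 0 ≤ b ∧ m * a + b = 1 ∧ m * a ^ 2 + b ^ 2 = P ∧ m * P ≤ 1 ∧ (m * P = 1 → b = 0) := by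
  have hm1 : 1 ≤ m := by
    rw [hm]; exact Nat.le_floor (by simpa using (one_le_inv₀ hP0).2 hP1)
  have hm0 : (0 : ℝ) < m := by exact_mod_cast hm1
  have l1 : m * P ≤ 1 := by
    have := Nat.floor_le (inv_nonneg.2 hP0.le)
    rw [← hm] at this
    calc m * P ≤ P⁻¹ * P := by gcongr
      _ = 1 := inv_mul_cancel₀ hP0.ne'
  have l2 : 1 < (m + 1) * P := by
    have := Nat.lt_floor_add_one P⁻¹
    rw [← hm] at this
    exact (inv_lt_iff_one_lt_mul₀ hP0).1 this
  set r := Real.sqrt (m * (P * (m + 1) - 1)) with hr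
  have hr0 : 0 ≤ r := Real.sqrt_nonneg _
  have hrsq : r ^ 2 = m * (P * (m + 1) - 1) :=
    Real.sq_sqrt (mul_nonneg hm0.le (by linarith))
  have hr1 : r ≤ 1 := by
    apply Real.sqrt_le_one.2 
    nlinarith
  have e : Real.sqrt ((P * (m + 1) - 1) / m) = r / m := by
    rw [Real.sqrt_eq_iff_mul_self_eq (div_nonneg (by linarith) hm0.le) (by positivity)]
    field_simp
    linarith
  rw [e] at ha
  have hma : m * a + b = 1 := by rw [ha, hb]; field_simp; ring
  refine ⟨by rw [ha]; positivity, by rw [hb]; exact div_nonneg (by linarith) (by linarith), hma,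
    ?_, l1, fun h => ?_⟩
  · rw [ha, hb]
    field_simp
    linear_combination (m + 1) * hrsq
  · have : r = 1 := by
      rw [hr, show (m : ℝ) * (P * (m + 1) - 1) = 1 by linear_combination (m + 1) * h]
      simp
    rw [hb, this]; simp

variable {n : ℕ}

/-! ### Rank-one projections of an orthonormal basis and spectral decomposition. -/

lemma ketBra_posSemidef (v : EuclideanSpace ℂ (Fin n)) : (ketBra v).PosSemidef :=
  Matrix.posSemidef_vecMulVec_self_star (fun i => v i)

lemma trace_ketBra_mul (v : EuclideanSpace ℂ (Fin n)) (B : Matrix (Fin n) (Fin n) ℂ) :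
    (ketBra v * B).trace = star (fun i => v i) ⬝ᵥ B.mulVec fun i => v i := by
  rw [ketBra, Matrix.trace_mul_comm, Matrix.mul_vecMulVec, Matrix.trace_vecMulVec,
    dotProduct_comm]
  rfl

lemma trace_ketBra_mul_nonneg (v : EuclideanSpace ℂ (Fin n)) {B : Matrix (Fin n) (Fin n) ℂ}
    (hB : B.PosSemidef) : 0 ≤ (ketBra v * B).trace.re := by
  rw [trace_ketBra_mul]
  exact (Complex.le_def.1 (hB.dotProduct_mulVec_nonneg _)).1

lemma dotProduct_orthonormalBasis (e : OrthonormalBasis (Fin n) ℂ (EuclideanSpace ℂ (Fin n)))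
    (k l : Fin n) : (star fun i => e k i) ⬝ᵥ (fun i => e l i) = if k = l then 1 else 0 := by
  rw [← orthonormal_iff_ite.1 e.orthonormal k l, EuclideanSpace.inner_eq_star_dotProduct,
    dotProduct_comm]

lemma sum_ketBra (e : OrthonormalBasis (Fin n) ℂ (EuclideanSpace ℂ (Fin n))) :
    ∑ k, ketBra (e k) = 1 := by
  set U : Matrix (Fin n) (Fin n) ℂ := Matrix.of fun i k => e k i
  have h : U.conjTranspose * U = 1 := by
    ext k l
    rw [Matrix.one_apply, ← dotProduct_orthonormalBasis e k l]
    rfl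
  have h2 := mul_eq_one_comm.1 h
  rw [← h2]
  ext i j
  simp [Matrix.sum_apply, Matrix.mul_apply, ketBra, Matrix.vecMulVec_apply, U]

lemma trace_ketBra_mul_ketBra (e : OrthonormalBasis (Fin n) ℂ (EuclideanSpace ℂ (Fin n)))
    (k l : Fin n) : (ketBra (e k) * ketBra (e l)).trace = if k = l then 1 else 0 := by
  rw [trace_ketBra_mul, ketBra, Matrix.vecMulVec_mulVec]
  have h1 := dotProduct_orthonormalBasis e l k
  have h2 := dotProduct_orthonormalBasis e k l
  change (star fun i => e l i) ⬝ᵥ _ = _ at h1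
  rw [show (fun i => star (e l i)) = star fun i => e l i from rfl, h1]
  by_cases h : k = l
  · subst h; simpa using h2
  · simp [h, Ne.symm h]

lemma trace_ketBra (e : OrthonormalBasis (Fin n) ℂ (EuclideanSpace ℂ (Fin n))) (k : Fin n) :
    (ketBra (e k)).trace = 1 := by
  have h := dotProduct_orthonormalBasis e k k
  rw [ketBra, Matrix.trace_vecMulVec, dotProduct_comm]
  exact h.trans (if_pos rfl)

lemma exists_eq_sum_ketBra {A : Matrix (Fin n) (Fin n) ℂ} (hA : A.PosSemidef) :
    ∃ (μ : Fin n → ℝ) (e : OrthonormalBasis (Fin n) ℂ (EuclideanSpace ℂ (Fin n))),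
      (∀ k, 0 ≤ μ k) ∧ A = ∑ k, (μ k : ℂ) • ketBra (e k) := by
  refine ⟨hA.1.eigenvalues, hA.1.eigenvectorBasis, hA.eigenvalues_nonneg, ?_⟩
  conv_lhs => rw [← Matrix.mul_one A, ← sum_ketBra hA.1.eigenvectorBasis, Finset.mul_sum]
  refine Finset.sum_congr rfl fun k _ => ?_
  have := hA.1.mulVec_eigenvectorBasis k
  rw [ketBra, Matrix.mul_vecMulVec, ← Matrix.smul_vecMulVec]
  congr 1

lemma trace_sum_smul_ketBra_mul (μ : Fin n → ℝ) (v : Fin n → EuclideanSpace ℂ (Fin n))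
    (B : Matrix (Fin n) (Fin n) ℂ) :
    ((∑ k, (μ k : ℂ) • ketBra (v k)) * B).trace.re = ∑ k, μ k * (ketBra (v k) * B).trace.re := by
  simp [Finset.sum_mul, Matrix.trace_sum]

/-! ### Outcome probabilities and the upper bound on the mutual information. -/

lemma OpFamily.integrable_trace_mul (F : OpFamily n) (A : Matrix (Fin n) (Fin n) ℂ) :
    Integrable (fun x => (A * F.op x).trace) F.μ := by
  simp only [Matrix.trace, Matrix.diag, Matrix.mul_apply]
  exact integrable_finsetSum _ fun i _ => integrable_finsetSum _ fun j _ =>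
    (F.integrable j i).const_mul _

lemma OpFamily.integrable_re_trace_mul (F : OpFamily n) (A : Matrix (Fin n) (Fin n) ℂ) :
    Integrable (fun x => (A * F.op x).trace.re) F.μ :=
  (F.integrable_trace_mul A).re

lemma OpFamily.integral_re_trace_mul (F : OpFamily n) (A : Matrix (Fin n) (Fin n) ℂ) :
    ∫ x, (A * F.op x).trace.re ∂F.μ = (A * F.total).trace.re := by
  have h : ∫ x, (A * F.op x).trace ∂F.μ = (A * F.total).trace := by
    simp only [Matrix.trace, Matrix.diag, Matrix.mul_apply]
    exact (integral_finsetSum _ fun i _ => integrable_finsetSum _ fun j _ =>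
      (F.integrable j i).const_mul _).trans (Finset.sum_congr rfl fun i _ =>
        (integral_finsetSum _ fun j _ => (F.integrable j i).const_mul _).trans
          (Finset.sum_congr rfl fun j _ => integral_const_mul _ _))
  rw [← h]
  exact integral_re (F.integrable_trace_mul A)

lemma integrable_born (E : Ensemble n) (M : POVM n) :
    Integrable (fun z : E.X × M.X => born E M z.1 z.2) (E.μ.prod M.μ) := by
  have : Integrable (fun z : E.X × M.X => (E.op z.1 * M.op z.2).trace) (E.μ.prod M.μ) := by
    simp only [Matrix.trace, Matrix.diag, Matrix.mul_apply]
    exact integrable_finsetSum _ fun i _ => integrable_finsetSum _ fun j _ =>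
      (E.integrable i j).mul_prod (M.integrable j i)
  exact this.re

lemma born_nonneg (E : Ensemble n) (M : POVM n) (x : E.X) (y : M.X) : 0 ≤ born E M x y := by
  obtain ⟨μ, e, hμ, h⟩ := exists_eq_sum_ketBra (E.posSemidef x)
  rw [born, h, trace_sum_smul_ketBra_mul]
  exact Finset.sum_nonneg fun k _ =>
    mul_nonneg (hμ k) (trace_ketBra_mul_nonneg _ (M.posSemidef y))

lemma integral_born_right (E : Ensemble n) (M : POVM n) (x : E.X) :
    ∫ y, born E M x y ∂M.μ = (E.op x).trace.re := by
  simp only [born]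
  rw [M.integral_re_trace_mul, M.total_eq_one, mul_one]

lemma integral_born_left (E : Ensemble n) (M : POVM n) (y : M.X) :
    ∫ x, born E M x y ∂E.μ = (E.total * M.op y).trace.re := by
  simp only [born, Matrix.trace_mul_comm _ (M.op y)]
  exact E.integral_re_trace_mul _

/-- Pointwise form of the bound on the mutual information: the first two terms come from Jensen's
inequality for `t ln t`, the others from `ln t ≤ t - 1`. -/
lemma mul_log_div_le {ι : Type*} [Fintype ι] {μ d : ι → ℝ} (hμ : ∀ k, 0 ≤ μ k)
    (hd : ∀ k, 0 ≤ d k) {r N : ℝ} (hr : 0 ≤ r) (hN : 0 < N) :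
    (∑ k, μ k * d k) * Real.log ((∑ k, μ k * d k) / ((∑ k, μ k) * r)) ≤
      (∑ k, μ k) * ∑ k, (μ k / (∑ k, μ k) * Real.log (μ k / (∑ k, μ k))) * d k +
      (∑ k, μ k * d k) * Real.log N +
      ((∑ k, μ k) * ((∑ k, d k) / N * (1 - r / r)) + (∑ k, μ k * d k) * ((∑ k, d k) / (N * r))) -
      ∑ k, μ k * d k := by
  set s := ∑ k, μ k with hs
  set q := ∑ k, d k with hq
  set p := ∑ k, μ k * d k with hp
  have hs0 : 0 ≤ s := Finset.sum_nonneg fun k _ => hμ k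
  have hq0 : 0 ≤ q := Finset.sum_nonneg fun k _ => hd k
  have hp0 : 0 ≤ p := Finset.sum_nonneg fun k _ => mul_nonneg (hμ k) (hd k)
  rcases hp0.eq_or_lt with hp1 | hp1
  · have hz : ∀ k, μ k * d k = 0 := fun k =>
      (Finset.sum_eq_zero_iff_of_nonneg fun k _ => mul_nonneg (hμ k) (hd k)).1 (hp ▸ hp1.symm) k
        (Finset.mem_univ k)
    have hT : ∑ k, (μ k / s * Real.log (μ k / s)) * d k = 0 := by
      refine Finset.sum_eq_zero fun k _ => ?_
      rw [show μ k / s * Real.log (μ k / s) * d k = (μ k * d k) / s * Real.log (μ k / s) by ring,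
        hz k]
      simp
    rw [hT, ← hp1]
    have : 0 ≤ 1 - r / r := sub_nonneg.2 (div_self_le_one r)
    have : 0 ≤ s * (q / N * (1 - r / r)) := by positivity
    simpa using this
  have hs1 : 0 < s := by
    refine hs0.lt_of_ne fun h => hp1.ne' ?_
    have hz := (Finset.sum_eq_zero_iff_of_nonneg fun k _ => hμ k).1 (hs ▸ h.symm)
    exact Finset.sum_eq_zero fun k hk => by rw [hz k hk, zero_mul]
  have hq1 : 0 < q := by
    refine hq0.lt_of_ne fun h => hp1.ne' ?_
    have hz := (Finset.sum_eq_zero_iff_of_nonneg fun k _ => hd k).1 (hq ▸ h.symm)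
    exact Finset.sum_eq_zero fun k hk => by rw [hz k hk, mul_zero]
  have hJ : p * Real.log (p / (s * q)) ≤ s * ∑ k, (μ k / s * Real.log (μ k / s)) * d k := by
    have h := Real.convexOn_mul_log.map_sum_le (t := Finset.univ) (w := fun k => d k / q)
      (p := fun k => μ k / s) (fun k _ => div_nonneg (hd k) hq0)
      (by rw [← Finset.sum_div]; exact div_self hq1.ne') fun k _ => div_nonneg (hμ k) hs0
    simp only [smul_eq_mul] at h
    have e1 : ∑ k, d k / q * (μ k / s) = p / (s * q) := by
      rw [hp, Finset.sum_div]
      exact Finset.sum_congr rfl fun k _ => by field_simp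
    rw [e1] at h
    have h2 := mul_le_mul_of_nonneg_left h (mul_pos hs1 hq1).le
    refine (le_of_eq ?_).trans (h2.trans (le_of_eq ?_))
    · field_simp
    · rw [mul_assoc, Finset.mul_sum]
      congr 1
      exact Finset.sum_congr rfl fun k _ => by field_simp
  have hlog : Real.log (p / (s * q)) = Real.log p - Real.log s - Real.log q := by
    rw [Real.log_div hp1.ne' (by positivity), Real.log_mul hs1.ne' hq1.ne']; ring
  rcases hr.eq_or_lt with rfl | hr1
  -- At `r = 0` division by zero makes the left side 0 even though `p > 0`. The term `s q / N`,
  -- switched on by `1 - r / r = 1`, keeps the inequality true.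
  · have h := Real.log_le_sub_one_of_pos (x := s * q / (N * p)) (by positivity)
    rw [Real.log_div (by positivity) (by positivity), Real.log_mul hs1.ne' hq1.ne',
      Real.log_mul hN.ne' hp1.ne'] at h
    have h2 := mul_le_mul_of_nonneg_left h hp0
    have e : p * (s * q / (N * p) - 1) = s * (q / N) - p := by field_simp
    rw [e] at h2
    rw [hlog] at hJ
    simp only [mul_zero, div_zero, Real.log_zero, sub_zero, mul_one, add_zero]
    linarith
  -- The pointwise Gibbs inequality, comparing `r` with `q / N`.
  · have h := Real.log_le_sub_one_of_pos (x := q / (N * r)) (by positivity)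
    rw [Real.log_div hq1.ne' (by positivity), Real.log_mul hN.ne' hr1.ne'] at h
    have h2 := mul_le_mul_of_nonneg_left h hp0
    rw [Real.log_div hp1.ne' (by positivity), Real.log_mul hs1.ne' hr1.ne', div_self hr1.ne']
    rw [hlog] at hJ
    simp only [sub_self, mul_zero, zero_add]
    linarith

lemma re_trace_sum_smul_ketBra (μ : Fin n → ℝ)
    (e : OrthonormalBasis (Fin n) ℂ (EuclideanSpace ℂ (Fin n))) :
    (∑ k, (μ k : ℂ) • ketBra (e k)).trace.re = ∑ k, μ k := by
  simp [Matrix.trace_sum, trace_ketBra]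

lemma re_trace_sq_sum_smul_ketBra (μ : Fin n → ℝ)
    (e : OrthonormalBasis (Fin n) ℂ (EuclideanSpace ℂ (Fin n))) :
    ((∑ k, (μ k : ℂ) • ketBra (e k)) * ∑ k, (μ k : ℂ) • ketBra (e k)).trace.re =
      ∑ k, μ k ^ 2 := by
  rw [trace_sum_smul_ketBra_mul]
  refine Finset.sum_congr rfl fun k _ => ?_
  rw [Matrix.trace_mul_comm, trace_sum_smul_ketBra_mul]
  simp [trace_ketBra_mul_ketBra, apply_ite Complex.re, sq]

/-- Normalized by the trace, the eigenvalues form a point of `simplexBall`, since the purity is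
their sum of squares. -/
lemma sum_mul_log_le_of_purity_le {P K : ℝ}
    (hK : ∀ l ∈ simplexBall (Fin n) P, ∑ k, l k * Real.log (l k) ≤ K)
    {μ : Fin n → ℝ} (hμ : ∀ k, 0 ≤ μ k)
    (e : OrthonormalBasis (Fin n) ℂ (EuclideanSpace ℂ (Fin n)))
    (hP : purity (∑ k, (μ k : ℂ) • ketBra (e k)) ≤ P) :
    (∑ k, μ k) * ∑ k, μ k / (∑ k, μ k) * Real.log (μ k / (∑ k, μ k)) ≤ (∑ k, μ k) * K := by
  have hs0 : 0 ≤ ∑ k, μ k := Finset.sum_nonneg fun k _ => hμ k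
  rcases hs0.eq_or_lt with h | hs
  · rw [← h]; simp
  refine mul_le_mul_of_nonneg_left (hK _ ⟨fun k => div_nonneg (hμ k) hs0, ?_, ?_⟩) hs0
  · rw [← Finset.sum_div, div_self hs.ne']
  · refine le_trans (le_of_eq ?_) hP
    rw [purity, re_trace_sum_smul_ketBra, re_trace_sq_sum_smul_ketBra, Finset.sum_div]
    simp only [div_pow]

lemma mutualInfo_le [NeZero n] (E : Ensemble n) (M : POVM n) {P K : ℝ}
    (hK : ∀ l ∈ simplexBall (Fin n) P, ∑ k, l k * Real.log (l k) ≤ K)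
    (hv : 0 ≤ Real.log n + K) (hE : E.PurityLE P) : mutualInfo E M ≤ Real.log n + K := by
  have hn : (0 : ℝ) < n := by exact_mod_cast NeZero.pos n
  rw [mutualInfo]
  simp only [integral_born_right, integral_born_left]
  set r : M.X → ℝ := fun y => (E.total * M.op y).trace.re with hr
  set q : M.X → ℝ := fun y => (M.op y).trace.re with hq
  set s : E.X → ℝ := fun x => (E.op x).trace.re with hs
  by_cases hint : Integrable (fun z : E.X × M.X => born E M z.1 z.2 *
    Real.log (born E M z.1 z.2 / (s z.1 * r z.2))) (E.μ.prod M.μ)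
  swap
  -- A non-integrable integrand gives the Bochner value 0, which explains the hypothesis `hv`.
  · rw [integral_undef hint]; exact hv
  have hq0 : ∀ y, 0 ≤ q y := fun y => (Complex.le_def.1 (M.posSemidef y).trace_nonneg).1
  have hr0 : ∀ y, 0 ≤ r y := fun y => by
    simp only [hr, ← integral_born_left]
    exact integral_nonneg fun x => born_nonneg E M x y
  have hri : Integrable r M.μ := M.integrable_re_trace_mul _
  have hqi : Integrable q M.μ := by simpa using M.integrable_re_trace_mul 1
  have hsi : Integrable s E.μ := by simpa using E.integrable_re_trace_mul 1
  have hqint : ∫ y, q y ∂M.μ = n := by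
    have := M.integral_re_trace_mul 1
    simpa [M.total_eq_one] using this
  have hsint : ∫ x, s x ∂E.μ = 1 := by
    have := E.integral_re_trace_mul 1
    simpa [E.trace_total] using this
  have hbi := integrable_born E M
  have hbl : ∀ y, Integrable (fun x => born E M x y) E.μ := fun y => by
    simp only [born, Matrix.trace_mul_comm _ (M.op y)]
    exact E.integrable_re_trace_mul _
  have hbr : ∀ x, Integrable (fun y => born E M x y) M.μ := fun x =>
    M.integrable_re_trace_mul _
  have hcut : Integrable (fun y => q y / n * (1 - r y / r y)) M.μ := by
    refine (hqi.div_const (n : ℝ)).mono ?_ (Filter.Eventually.of_forall fun y => ?_)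
    · exact ((hqi.1.aemeasurable.div_const _).mul
        ((hri.1.aemeasurable.div hri.1.aemeasurable).const_sub 1)).aestronglyMeasurable
    · have h0 : 0 ≤ r y / r y := div_nonneg (hr0 y) (hr0 y)
      have h1 : r y / r y ≤ 1 := div_self_le_one _
      have h2 : 0 ≤ q y / n := div_nonneg (hq0 y) hn.le
      rw [Real.norm_of_nonneg h2, Real.norm_of_nonneg (mul_nonneg h2 (by linarith))]
      exact mul_le_of_le_one_right h2 (by linarith)
  -- The first summand acts where `r = 0`, the second where `r > 0`. Integrating out `x` leaves `q /
  -- n` for every `y`, so `G` has total mass exactly 1 and cancels `∫ s = 1`.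
  set G : E.X × M.X → ℝ := fun z => s z.1 * (q z.2 / n * (1 - r z.2 / r z.2)) +
    born E M z.1 z.2 * (q z.2 / (n * r z.2)) with hG
  have hG1 : Integrable (fun z : E.X × M.X => s z.1 * (q z.2 / n * (1 - r z.2 / r z.2)))
    (E.μ.prod M.μ) := hsi.mul_prod hcut
  have hrb : ∀ y, ∫ x, born E M x y ∂E.μ = r y := integral_born_left E M
  have hrq : ∀ y, r y * (q y / (n * r y)) = q y / n * (r y / r y) := fun y => by
    rw [div_mul_eq_div_div]; ring
  have hG2 : Integrable (fun z : E.X × M.X => born E M z.1 z.2 * (q z.2 / (n * r z.2)))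
      (E.μ.prod M.μ) := by
    have hm : AEMeasurable (fun y => q y / (n * r y)) M.μ :=
      hqi.1.aemeasurable.div (hri.1.aemeasurable.const_mul _)
    refine (integrable_prod_iff' (hbi.1.mul hm.aestronglyMeasurable.comp_snd)).2
      ⟨Filter.Eventually.of_forall fun y => (hbl y).mul_const (q y / (n * r y)), ?_⟩
    have e : ∀ y, ∫ x, ‖born E M x y * (q y / (n * r y))‖ ∂E.μ = q y / n * (r y / r y) := by
      intro y
      rw [← hrq, ← hrb, ← integral_mul_const]
      refine integral_congr_ae (Filter.Eventually.of_forall fun x => ?_)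
      refine Real.norm_of_nonneg (mul_nonneg (born_nonneg E M x y) ?_)
      exact div_nonneg (hq0 y) (mul_nonneg hn.le (hrb y ▸ hr0 y))
    change Integrable (fun y => ∫ x, ‖born E M x y * (q y / (n * r y))‖ ∂E.μ) M.μ
    simp only [e]
    refine ((hqi.div_const (n : ℝ)).sub hcut).congr (Filter.Eventually.of_forall fun y => ?_)
    simp only [Pi.sub_apply]
    ring
  have hGi : Integrable G (E.μ.prod M.μ) := hG1.add hG2
  have hGint : ∫ z, G z ∂(E.μ.prod M.μ) = 1 := by
    rw [integral_prod_symm _ hGi]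
    have e : ∀ y, ∫ x, G (x, y) ∂E.μ = q y / n := by
      intro y
      simp only [hG]
      rw [integral_add (hsi.mul_const _) ((hbl y).mul_const _), integral_mul_const,
        integral_mul_const, hsint, hrb, hrq]
      ring
    simp only [e]
    rw [integral_div, hqint, div_self hn.ne']
  have key : ∀ᵐ x ∂E.μ, ∫ y, born E M x y * Real.log (born E M x y / (s x * r y)) ∂M.μ ≤
      s x * (Real.log n + K) + ∫ y, G (x, y) ∂M.μ - s x := by
    filter_upwards [hint.prod_right_ae, hGi.prod_right_ae, hE] with x hx1 hx2 hx3
    obtain ⟨μ, e, hμ, h⟩ := exists_eq_sum_ketBra (E.posSemidef x)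
    -- The outcome density of the `k`-th eigenvector: it sums to `q` over `k` and integrates to 1
    -- over `y`.
    set d : Fin n → M.X → ℝ := fun k y => (ketBra (e k) * M.op y).trace.re with hd
    have hd0 : ∀ k y, 0 ≤ d k y := fun k y => trace_ketBra_mul_nonneg _ (M.posSemidef y)
    have hdi : ∀ k, Integrable (d k) M.μ := fun k => M.integrable_re_trace_mul _
    have hdint : ∀ k, ∫ y, d k y ∂M.μ = 1 := fun k => by
      simp only [hd]
      rw [M.integral_re_trace_mul, M.total_eq_one, mul_one, trace_ketBra, Complex.one_re]
    have hb : ∀ y, born E M x y = ∑ k, μ k * d k y := fun y => by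
      rw [born, h, trace_sum_smul_ketBra_mul]
    have hsx : s x = ∑ k, μ k := by
      simp only [hs]
      rw [h, re_trace_sum_smul_ketBra]
    have hqy : ∀ y, q y = ∑ k, d k y := fun y => by
      simp only [hq, hd]
      rw [← Complex.re_sum, ← Matrix.trace_sum, ← Finset.sum_mul, sum_ketBra, one_mul]
    have hpt : ∀ y, born E M x y * Real.log (born E M x y / (s x * r y)) ≤
        s x * ∑ k, (μ k / s x * Real.log (μ k / s x)) * d k y + born E M x y * Real.log n +
          G (x, y) - born E M x y := fun y => by
      simp only [hG]
      rw [hb, hqy, hsx]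
      exact mul_log_div_le hμ (fun k => hd0 k y) (hr0 y) hn
    have i1 : Integrable (fun y => s x * ∑ k, (μ k / s x * Real.log (μ k / s x)) * d k y) M.μ :=
      (integrable_finsetSum _ fun k _ => (hdi k).const_mul _).const_mul _
    have i2 : Integrable (fun y => born E M x y * Real.log n) M.μ := (hbr x).mul_const _
    have i3 : Integrable (fun y => s x * ∑ k, (μ k / s x * Real.log (μ k / s x)) * d k y +
        born E M x y * Real.log n) M.μ := i1.add i2
    have i4 : Integrable (fun y => s x * ∑ k, (μ k / s x * Real.log (μ k / s x)) * d k y +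
        born E M x y * Real.log n + G (x, y)) M.μ := i3.add hx2
    have hpur := sum_mul_log_le_of_purity_le hK hμ e (h ▸ hx3)
    rw [← hsx] at hpur
    calc _ ≤ ∫ y, (s x * ∑ k, (μ k / s x * Real.log (μ k / s x)) * d k y +
          born E M x y * Real.log n + G (x, y) - born E M x y) ∂M.μ :=
          integral_mono hx1 (i4.sub (hbr x)) hpt
      _ = s x * ∑ k, (μ k / s x * Real.log (μ k / s x)) + s x * Real.log n +
          ∫ y, G (x, y) ∂M.μ - s x := by
          rw [integral_sub i4 (hbr x), integral_add i3 hx2,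
            integral_add i1 i2, integral_const_mul, integral_mul_const, integral_born_right,
            integral_finsetSum _ fun k _ => (hdi k).const_mul _]
          simp only [integral_const_mul, hdint, mul_one, hs]
      _ ≤ _ := by linarith
  rw [integral_prod _ hint]
  have i3 : Integrable (fun x => s x * (Real.log n + K)) E.μ := hsi.mul_const _
  have i4 : Integrable (fun x => s x * (Real.log n + K) + ∫ y, G (x, y) ∂M.μ) E.μ :=
    i3.add hGi.integral_prod_left
  refine (integral_mono_ae hint.integral_prod_left (i4.sub hsi) key).trans (le_of_eq ?_)
  simp only [Pi.sub_apply]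
  rw [integral_sub i4 hsi, integral_add i3 hGi.integral_prod_left,
    ← integral_prod _ hGi, hGint, hsint, integral_mul_const, hsint]
  ring

/-! ### Finite ensembles and POVMs, and the two-level states. -/

/-- A finite POVM, given by a list of operators. -/
noncomputable def POVM.ofFin {N : ℕ} (π : Fin N → Matrix (Fin n) (Fin n) ℂ)
    (hpos : ∀ y, (π y).PosSemidef) (hsum : ∑ y, π y = 1) : POVM n where
  X := Fin N
  μ := Measure.count
  op := π
  posSemidef := hpos
  integrable := fun _ _ => Integrable.of_finite
  total_eq_one := by
    rw [← hsum]
    ext i j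
    simp [OpFamily.total, Matrix.sum_apply]

lemma Ensemble.total_ofFin {N : ℕ} (ρ : Fin N → Matrix (Fin n) (Fin n) ℂ)
    (hpos : ∀ x, (ρ x).PosSemidef) (htr : (∑ x, ρ x).trace = 1) :
    (Ensemble.ofFin ρ hpos htr).total = ∑ x, ρ x := by
  ext i j
  simp only [OpFamily.total, Matrix.of_apply, Matrix.sum_apply]
  exact integral_count (fun x => ρ x i j)

lemma mutualInfo_ofFin {N N' : ℕ} (ρ : Fin N → Matrix (Fin n) (Fin n) ℂ)
    (hpos : ∀ x, (ρ x).PosSemidef) (htr : (∑ x, ρ x).trace = 1)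
    (π : Fin N' → Matrix (Fin n) (Fin n) ℂ) (hpos' : ∀ y, (π y).PosSemidef)
    (hsum : ∑ y, π y = 1) {p : Fin N → Fin N' → ℝ} (hp : ∀ x y, (ρ x * π y).trace.re = p x y) :
    mutualInfo (Ensemble.ofFin ρ hpos htr) (POVM.ofFin π hpos' hsum) =
      ∑ x, ∑ y, p x y * Real.log (p x y / ((∑ y, p x y) * ∑ x, p x y)) := by
  obtain rfl : (fun x y => (ρ x * π y).trace.re) = p := by ext x y; exact hp x y
  change ∫ z : Fin N × Fin N', (ρ z.1 * π z.2).trace.re *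
    Real.log ((ρ z.1 * π z.2).trace.re / ((∫ y, (ρ z.1 * π y).trace.re ∂Measure.count) *
      ∫ x, (ρ x * π z.2).trace.re ∂Measure.count)) ∂(Measure.count.prod Measure.count) = _
  rw [integral_prod _ Integrable.of_finite]
  simp only [integral_count]

/-- The mutual information of a joint distribution `L / n` with `L` doubly stochastic. -/
lemma sum_mul_log_doublyStochastic [NeZero n] {L : Fin n → Fin n → ℝ}
    (h1 : ∀ x, ∑ y, L x y = 1) (h2 : ∀ y, ∑ x, L x y = 1) :
    ∑ x, ∑ y, L x y / n * Real.log (L x y / n / ((∑ y, L x y / n) * ∑ x, L x y / n)) =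
      Real.log n + (∑ x, ∑ y, L x y * Real.log (L x y)) / n := by
  have hn : (n : ℝ) ≠ 0 := by exact_mod_cast NeZero.ne n
  have h : ∀ x y, L x y / n * Real.log (L x y / n / ((∑ y, L x y / n) * ∑ x, L x y / n)) =
      L x y * (Real.log n / n) + L x y * Real.log (L x y) / n := by
    intro x y
    rw [← Finset.sum_div, ← Finset.sum_div, h1, h2]
    by_cases h0 : L x y = 0
    · simp [h0]
    · rw [show L x y / n / (1 / n * (1 / n)) = n * L x y by field_simp, Real.log_mul hn h0]
      ring
  rw [Finset.sum_congr rfl fun x _ => Finset.sum_congr rfl fun y _ => h x y]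
  simp only [Finset.sum_add_distrib, ← Finset.sum_mul, ← Finset.sum_div, h1]
  simp
  field_simp

lemma sum_twoLevel {m : ℕ} (hm : m ≤ n) {a b : ℝ} (hb : m = n → b = 0) (f : ℝ → ℝ)
    (hf : f 0 = 0) : ∑ k : Fin n, f (twoLevel m a b k) = m * f a + f b := by
  have h : ∀ k : ℕ, f (if k < m then a else if k = m then b else 0) =
      (if k < m then f a else 0) + if k = m then f b else 0 := by
    intro k
    rcases lt_trichotomy k m with h | h | h
    · simp [h, h.ne]
    · simp [h]
    · simp [h.not_gt, h.ne', hf]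
  simp only [twoLevel, h]
  rw [Fin.sum_univ_eq_sum_range (fun k => (if k < m then f a else 0) + if k = m then f b else 0),
    Finset.sum_add_distrib, Finset.sum_ite_eq', ← Finset.sum_filter,
    show (Finset.range n).filter (· < m) = Finset.range m by ext; simp; omega]
  rcases hm.eq_or_lt with h | h
  · simp [h, hb h, hf]
  · simp [h]

section TwoLevel

variable (e : OrthonormalBasis (Fin n) ℂ (EuclideanSpace ℂ (Fin n))) {m : ℕ} {a b : ℝ}

lemma twoLevelState_eq (s : Equiv.Perm (Fin n)) : twoLevelState e m a b s =
    ∑ k, (twoLevel m a b k : ℂ) • ketBra (e.reindex s.symm k) := by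
  simp [twoLevelState]

lemma twoLevel_nonneg (ha : 0 ≤ a) (hb : 0 ≤ b) (k : Fin n) : 0 ≤ twoLevel m a b k := by
  unfold twoLevel
  split_ifs <;> first | assumption | exact le_rfl

lemma twoLevelState_posSemidef (ha : 0 ≤ a) (hb : 0 ≤ b) (s : Equiv.Perm (Fin n)) :
    (twoLevelState e m a b s).PosSemidef :=
  Matrix.posSemidef_sum _ fun k _ => (ketBra_posSemidef _).smul
    (Complex.zero_le_real.2 (twoLevel_nonneg ha hb k))

lemma trace_twoLevelState_mul_ketBra (s : Equiv.Perm (Fin n)) (j : Fin n) :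
    (twoLevelState e m a b s * ketBra (e j)).trace = twoLevel m a b (s.symm j) := by
  simp [twoLevelState, Finset.sum_mul, Matrix.trace_sum, trace_ketBra_mul_ketBra,
    ← Equiv.eq_symm_apply]

/-- The column sums of the doubly stochastic matrix, read off from the diagonal of `∑ ρ_x = 1` in
the basis `e`; its rows are permutations of the spectrum. -/
lemma sum_twoLevel_symm {σ : Fin n → Equiv.Perm (Fin n)}
    (hσ : ∑ x, twoLevelState e m a b (σ x) = 1) (j : Fin n) :
    ∑ x, twoLevel m a b ((σ x).symm j) = 1 := by
  have h := congrArg (fun A => (A * ketBra (e j)).trace) hσ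
  simp only [Finset.sum_mul, Matrix.trace_sum, trace_twoLevelState_mul_ketBra, one_mul,
    trace_ketBra] at h
  exact_mod_cast h

lemma sum_twoLevelState_addLeft [NeZero n] (h : ∑ k : Fin n, twoLevel m a b k = 1) :
    ∑ x : Fin n, twoLevelState e m a b (Equiv.addLeft x) = 1 := by
  simp only [twoLevelState]
  rw [Finset.sum_comm]
  have : ∀ k : Fin n, ∑ x : Fin n, ketBra (e (Equiv.addLeft x k)) = 1 := fun k => by
    rw [← sum_ketBra e]
    -- For fixed `k`, `x + k` runs over every label as `x` does.
    exact Equiv.sum_comp (Equiv.addRight k) fun j => ketBra (e j)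
  simp only [← Finset.smul_sum, this, ← Finset.sum_smul]
  rw [← Complex.ofReal_sum, h, Complex.ofReal_one, one_smul]

lemma purity_smul {c : ℝ} (hc : c ≠ 0) (A : Matrix (Fin n) (Fin n) ℂ) :
    purity ((c : ℂ) • A) = purity A := by
  simp only [purity, smul_mul_assoc, mul_smul_comm, Matrix.trace_smul, smul_eq_mul,
    Complex.re_ofReal_mul]
  rw [← mul_assoc, ← sq, mul_pow, mul_div_mul_left _ _ (pow_ne_zero 2 hc)]

end TwoLevel

lemma posSemidef_one_div_smul {A : Matrix (Fin n) (Fin n) ℂ} (hA : A.PosSemidef) :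
    ((1 / n : ℂ) • A).PosSemidef :=
  hA.smul (by rw [← Complex.ofReal_natCast, ← Complex.ofReal_one, ← Complex.ofReal_div]
              exact Complex.zero_le_real.2 (by positivity))

lemma trace_one_div_smul_one [NeZero n] :
    ((1 / n : ℂ) • (1 : Matrix (Fin n) (Fin n) ℂ)).trace = 1 := by
  have hn : (n : ℂ) ≠ 0 := by exact_mod_cast NeZero.ne n
  rw [Matrix.trace_smul, Matrix.trace_one, Fintype.card_fin, smul_eq_mul, one_div,
    inv_mul_cancel₀ hn]

lemma re_trace_one_div_smul_mul (A B : Matrix (Fin n) (Fin n) ℂ) :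
    (((1 / n : ℂ) • A) * B).trace.re = (A * B).trace.re / n := by
  rw [smul_mul_assoc, Matrix.trace_smul, smul_eq_mul, one_div_mul_eq_div, Complex.div_natCast_re]

lemma isState_twoLevelState (e : OrthonormalBasis (Fin n) ℂ (EuclideanSpace ℂ (Fin n))) {m : ℕ}
    {a b : ℝ} (ha : 0 ≤ a) (hb : 0 ≤ b) (h1 : ∑ k : Fin n, twoLevel m a b k = 1)
    (s : Equiv.Perm (Fin n)) : IsState (twoLevelState e m a b s) := by
  refine ⟨twoLevelState_posSemidef e ha hb s, ?_⟩
  simp only [twoLevelState, Matrix.trace_sum, Matrix.trace_smul, trace_ketBra, smul_eq_mul,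
    mul_one]
  exact_mod_cast h1

lemma purity_twoLevelState (e : OrthonormalBasis (Fin n) ℂ (EuclideanSpace ℂ (Fin n))) {m : ℕ}
    {a b : ℝ} (h1 : ∑ k : Fin n, twoLevel m a b k = 1) (s : Equiv.Perm (Fin n)) :
    purity (twoLevelState e m a b s) = ∑ k : Fin n, twoLevel m a b k ^ 2 := by
  rw [purity, twoLevelState_eq, re_trace_sq_sum_smul_ketBra, re_trace_sum_smul_ketBra, h1,
    one_pow, div_one]

lemma sum_sum_mul_log_twoLevel {m : ℕ} {a b : ℝ} (σ : Fin n → Equiv.Perm (Fin n)) :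
    ∑ x, ∑ y, twoLevel m a b ((σ x).symm y) * Real.log (twoLevel m a b ((σ x).symm y)) =
      n * ∑ k : Fin n, twoLevel m a b k * Real.log (twoLevel m a b k) := by
  have h : ∀ x, ∑ y, twoLevel m a b ((σ x).symm y) * Real.log (twoLevel m a b ((σ x).symm y)) =
      ∑ k : Fin n, twoLevel m a b k * Real.log (twoLevel m a b k) := fun x =>
    Equiv.sum_comp (σ x).symm fun k => twoLevel m a b k * Real.log (twoLevel m a b k)
  simp [h]

lemma mutualInfo_twoLevelState_ketBra [NeZero n]
    (e : OrthonormalBasis (Fin n) ℂ (EuclideanSpace ℂ (Fin n))) {m : ℕ} {a b : ℝ}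
    (h1 : ∑ k : Fin n, twoLevel m a b k = 1) {σ : Fin n → Equiv.Perm (Fin n)}
    (hσ : ∑ x, twoLevelState e m a b (σ x) = 1)
    (hpos : ∀ x, ((1 / n : ℂ) • twoLevelState e m a b (σ x)).PosSemidef)
    (htr : (∑ x, (1 / n : ℂ) • twoLevelState e m a b (σ x)).trace = 1) :
    mutualInfo (Ensemble.ofFin _ hpos htr)
      (POVM.ofFin (fun k => ketBra (e k)) (fun _ => ketBra_posSemidef _) (sum_ketBra e)) =
      Real.log n + ∑ k : Fin n, twoLevel m a b k * Real.log (twoLevel m a b k) := by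
  have hn : (n : ℝ) ≠ 0 := by exact_mod_cast NeZero.ne n
  rw [mutualInfo_ofFin _ hpos htr _ _ _ (p := fun x y => twoLevel m a b ((σ x).symm y) / n)
    fun x y => by
      rw [re_trace_one_div_smul_mul, trace_twoLevelState_mul_ketBra, Complex.ofReal_re]]
  rw [sum_mul_log_doublyStochastic
    (fun x => (Equiv.sum_comp (σ x).symm fun k => twoLevel m a b k).trans h1)
    (sum_twoLevel_symm e hσ), sum_sum_mul_log_twoLevel, mul_div_cancel_left₀ _ hn]

/-- The dual configuration: `∑ ρ_x = 1` makes the unweighted states a POVM, probed by the uniform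
ensemble of basis states. The joint distribution is the transpose of the previous one. -/
lemma mutualInfo_ketBra_twoLevelState [NeZero n]
    (e : OrthonormalBasis (Fin n) ℂ (EuclideanSpace ℂ (Fin n))) {m : ℕ} {a b : ℝ}
    (h1 : ∑ k : Fin n, twoLevel m a b k = 1) {σ : Fin n → Equiv.Perm (Fin n)}
    (hσ : ∑ x, twoLevelState e m a b (σ x) = 1)
    (hpos : ∀ x, (twoLevelState e m a b (σ x)).PosSemidef)
    (hpos' : ∀ k, ((1 / n : ℂ) • ketBra (e k)).PosSemidef)
    (htr : (∑ k, (1 / n : ℂ) • ketBra (e k)).trace = 1) :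
    mutualInfo (Ensemble.ofFin _ hpos' htr) (POVM.ofFin _ hpos hσ) =
      Real.log n + ∑ k : Fin n, twoLevel m a b k * Real.log (twoLevel m a b k) := by
  have hn : (n : ℝ) ≠ 0 := by exact_mod_cast NeZero.ne n
  rw [mutualInfo_ofFin _ hpos' htr _ _ _ (p := fun y x => twoLevel m a b ((σ x).symm y) / n)
    fun y x => by
      rw [re_trace_one_div_smul_mul, Matrix.trace_mul_comm, trace_twoLevelState_mul_ketBra,
        Complex.ofReal_re]]
  rw [sum_mul_log_doublyStochastic (sum_twoLevel_symm e hσ)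
    (fun x => (Equiv.sum_comp (σ x).symm fun k => twoLevel m a b k).trans h1),
    Finset.sum_comm, sum_sum_mul_log_twoLevel, mul_div_cancel_left₀ _ hn]

/-- The uniform distribution bounds the entropies of the vectors of `simplexBall` from above. -/
lemma log_add_nonneg [NeZero n] {P K : ℝ} (hP : (1 : ℝ) / n ≤ P)
    (hK : ∀ l ∈ simplexBall (Fin n) P, ∑ k, l k * Real.log (l k) ≤ K) : 0 ≤ Real.log n + K := by
  have hn : (n : ℝ) ≠ 0 := by exact_mod_cast NeZero.ne n
  have h := hK (fun _ => 1 / n) ⟨fun _ => by positivity, by simp [hn], by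
    refine le_trans (le_of_eq ?_) hP
    simp
    field_simp⟩
  simp [hn] at h
  linarith

end QInfo

/-! ### Assembly of the bounds and the optimal ensembles. -/

theorem theorem2 (n : ℕ) [NeZero n] (P : ℝ) (hP : (1 : ℝ) / n ≤ P) (hP1 : P ≤ 1)
    (m : ℕ) (hm : m = ⌊P⁻¹⌋₊) (α a b v : ℝ) (hα : α = m + 1)
    (ha : a = (1 + Real.sqrt ((P * α - 1) / m)) / α)
    (hb : b = (1 - Real.sqrt (m * (P * α - 1))) / α)
    (hv : v = Real.log n + m * (a * Real.log a) + b * Real.log b) :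
    -- the lower bound on `S_W(P)`, and the value of the maximum over states of `S_A(ρ, P)`
    (v : EReal) ≤ QInfo.SW n P ∧
    IsGreatest {s : EReal | ∃ ρ : Matrix (Fin n) (Fin n) ℂ,
      QInfo.IsState ρ ∧ s = QInfo.SA ρ P} (v : EReal) ∧
    -- ensembles attaining the maximum
    (∀ (e : OrthonormalBasis (Fin n) ℂ (EuclideanSpace ℂ (Fin n)))
      (σ : Fin n → Equiv.Perm (Fin n)),
      ∑ x, (1 / n : ℂ) • QInfo.twoLevelState e m a b (σ x) = (1 / n : ℂ) • 1 →
      (∀ x, QInfo.IsState (QInfo.twoLevelState e m a b (σ x))) ∧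
      ∃ (hpos : ∀ x, ((1 / n : ℂ) • QInfo.twoLevelState e m a b (σ x)).PosSemidef)
        (htr : (∑ x, (1 / n : ℂ) • QInfo.twoLevelState e m a b (σ x)).trace = 1),
        (QInfo.Ensemble.ofFin _ hpos htr).PurityLE P ∧
        QInfo.accessibleInfo (QInfo.Ensemble.ofFin _ hpos htr) = (v : EReal) ∧
        ∃ M : QInfo.POVM n, QInfo.mutualInfo (QInfo.Ensemble.ofFin _ hpos htr) M = v) ∧
    -- such ensembles exist in every orthonormal basis: take the cyclic shifts
    (∀ e : OrthonormalBasis (Fin n) ℂ (EuclideanSpace ℂ (Fin n)),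
      ∑ x : Fin n, (1 / n : ℂ) • QInfo.twoLevelState e m a b (Equiv.addLeft x) =
        (1 / n : ℂ) • 1) := by
  have hn : (0 : ℝ) < n := by exact_mod_cast NeZero.pos n
  have hnc : (n : ℂ) ≠ 0 := by exact_mod_cast NeZero.ne n
  have hP0 : 0 < P := lt_of_lt_of_le (by positivity) hP
  subst hα
  obtain ⟨ha0, hb0, hab, hab2, hmP, hb1⟩ := QInfo.two_level_facts hP0 hP1 hm ha hb
  have hPn : 1 ≤ n * P := by
    rw [div_le_iff₀ hn] at hP
    linarith
  have hmn : m ≤ n := by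
    have : (m : ℝ) ≤ n := le_of_mul_le_mul_right (hmP.trans hPn) hP0
    exact_mod_cast this
  have hbn : m = n → b = 0 := by
    rintro rfl
    exact hb1 (le_antisymm hmP hPn)
  have h1 : ∑ k : Fin n, QInfo.twoLevel m a b k = 1 := by
    rw [QInfo.sum_twoLevel hmn hbn (fun x => x) rfl, hab]
  have h2 : ∑ k : Fin n, QInfo.twoLevel m a b k ^ 2 = P := by
    rw [QInfo.sum_twoLevel hmn hbn (fun x => x ^ 2) (by simp), hab2]
  have h3 : Real.log n + ∑ k : Fin n, QInfo.twoLevel m a b k *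
      Real.log (QInfo.twoLevel m a b k) = v := by
    rw [QInfo.sum_twoLevel hmn hbn (fun x => x * Real.log x) (by simp), hv]
    ring
  have hK : ∀ l ∈ QInfo.simplexBall (Fin n) P, ∑ k, l k * Real.log (l k) ≤
      m * (a * Real.log a) + b * Real.log b := fun l hl =>
    QInfo.sum_mul_log_le hP1 hm ha (by linarith) hl
  have hle : ∀ (E : QInfo.Ensemble n) (M : QInfo.POVM n), E.PurityLE P →
      QInfo.mutualInfo E M ≤ v := by
    intro E M hE
    rw [hv, add_assoc]
    exact QInfo.mutualInfo_le E M hK (QInfo.log_add_nonneg hP hK) hE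
  have hA : ∀ E : QInfo.Ensemble n, E.PurityLE P → QInfo.accessibleInfo E ≤ (v : EReal) :=
    fun E hE => iSup_le fun M => EReal.coe_le_coe_iff.2 (hle E M hE)
  have hpur : ∀ (e : OrthonormalBasis (Fin n) ℂ (EuclideanSpace ℂ (Fin n)))
      (s : Equiv.Perm (Fin n)), QInfo.purity (QInfo.twoLevelState e m a b s) ≤ P :=
    fun e s => by rw [QInfo.purity_twoLevelState e h1, h2]
  have hens : ∀ (e : OrthonormalBasis (Fin n) ℂ (EuclideanSpace ℂ (Fin n)))
      (σ : Fin n → Equiv.Perm (Fin n)),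
      ∑ x, (1 / n : ℂ) • QInfo.twoLevelState e m a b (σ x) = (1 / n : ℂ) • 1 →
      (∀ x, QInfo.IsState (QInfo.twoLevelState e m a b (σ x))) ∧
      ∃ (hpos : ∀ x, ((1 / n : ℂ) • QInfo.twoLevelState e m a b (σ x)).PosSemidef)
        (htr : (∑ x, (1 / n : ℂ) • QInfo.twoLevelState e m a b (σ x)).trace = 1),
        (QInfo.Ensemble.ofFin _ hpos htr).PurityLE P ∧
        QInfo.accessibleInfo (QInfo.Ensemble.ofFin _ hpos htr) = (v : EReal) ∧
        ∃ M : QInfo.POVM n, QInfo.mutualInfo (QInfo.Ensemble.ofFin _ hpos htr) M = v := by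
    intro e σ hσ
    have hσ1 : ∑ x, QInfo.twoLevelState e m a b (σ x) = 1 := by
      rw [← Finset.smul_sum] at hσ
      exact smul_right_injective _ (one_div_ne_zero hnc) hσ
    have hpos : ∀ x, ((1 / n : ℂ) • QInfo.twoLevelState e m a b (σ x)).PosSemidef := fun x =>
      QInfo.posSemidef_one_div_smul (QInfo.twoLevelState_posSemidef e ha0 hb0 _)
    have htr : (∑ x, (1 / n : ℂ) • QInfo.twoLevelState e m a b (σ x)).trace = 1 := by
      rw [hσ, QInfo.trace_one_div_smul_one]
    have hE : (QInfo.Ensemble.ofFin _ hpos htr).PurityLE P := by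
      refine Filter.Eventually.of_forall fun x => ?_
      change QInfo.purity ((1 / n : ℂ) • QInfo.twoLevelState e m a b (σ x)) ≤ P
      have h := QInfo.purity_smul (one_div_ne_zero hn.ne') (QInfo.twoLevelState e m a b (σ x))
      push_cast at h
      rw [h]
      exact hpur e _
    have hM := (QInfo.mutualInfo_twoLevelState_ketBra e h1 hσ1 hpos htr).trans h3
    refine ⟨fun x => QInfo.isState_twoLevelState e ha0 hb0 h1 _, hpos, htr, hE,
      le_antisymm (hA _ hE) ?_, _, hM⟩
    rw [← hM]
    exact le_iSup (fun M => (QInfo.mutualInfo (QInfo.Ensemble.ofFin _ hpos htr) M : EReal)) _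
  have hshift1 : ∀ e : OrthonormalBasis (Fin n) ℂ (EuclideanSpace ℂ (Fin n)),
      ∑ x : Fin n, QInfo.twoLevelState e m a b (Equiv.addLeft x) = 1 := fun e =>
    QInfo.sum_twoLevelState_addLeft e h1
  have hshift : ∀ e : OrthonormalBasis (Fin n) ℂ (EuclideanSpace ℂ (Fin n)),
      ∑ x : Fin n, (1 / n : ℂ) • QInfo.twoLevelState e m a b (Equiv.addLeft x) =
        (1 / n : ℂ) • 1 := fun e => by rw [← Finset.smul_sum, hshift1]
  set e₀ := EuclideanSpace.basisFun (Fin n) ℂ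
  refine ⟨?_, ⟨⟨(1 / n : ℂ) • 1, ⟨QInfo.posSemidef_one_div_smul Matrix.PosSemidef.one,
    QInfo.trace_one_div_smul_one⟩, ?_⟩, ?_⟩, hens, hshift⟩
  · have hpos : ∀ x : Fin n, (QInfo.twoLevelState e₀ m a b (Equiv.addLeft x)).PosSemidef :=
      fun x => QInfo.twoLevelState_posSemidef e₀ ha0 hb0 _
    have htr : (∑ k, (1 / n : ℂ) • QInfo.ketBra (e₀ k)).trace = 1 := by
      rw [← Finset.smul_sum, QInfo.sum_ketBra, QInfo.trace_one_div_smul_one]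
    have hM := (QInfo.mutualInfo_ketBra_twoLevelState e₀ h1 (hshift1 e₀) hpos
      (fun k => QInfo.posSemidef_one_div_smul (QInfo.ketBra_posSemidef _)) htr).trans h3
    rw [← hM]
    exact le_trans (le_iSup (fun E => (QInfo.mutualInfo E _ : EReal)) _)
      (le_iSup₂ (f := fun (M : QInfo.POVM n) (_ : M.PurityLE P) => QInfo.infoPower M)
        (QInfo.POVM.ofFin _ hpos (hshift1 e₀))
        (Filter.Eventually.of_forall fun x => hpur e₀ (Equiv.addLeft x)))
  -- The maximum over states is attained at `ρ = 1 / n`, the average of the cyclic-shift ensemble.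
  · obtain ⟨-, hpos, htr, hE, hAv, -⟩ := hens e₀ _ (hshift e₀)
    refine le_antisymm ?_ (iSup₂_le fun E hE => hA E hE.2)
    rw [← hAv]
    exact le_iSup₂ (f := fun (E : QInfo.Ensemble n)
      (_ : E.total = (1 / n : ℂ) • 1 ∧ E.PurityLE P) => QInfo.accessibleInfo E) _
      ⟨(QInfo.Ensemble.total_ofFin _ hpos htr).trans (hshift e₀), hE⟩
  · rintro _ ⟨ρ, -, rfl⟩
    exact iSup₂_le fun E hE => hA E hE.2
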